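/- Let $\mathcal X$ be a non-empty compact metric space and $S:\mathcal X\to\mathcal X$ a continuous map. Let $\mathcal Y$ be a non-empty Polish space, $T:\mathcal Y\to\mathcal Y$ a Borel measurable map, and $\nu$ a Borel probability measure on $\mathcal Y$ that is invariant and ergodic under $T$. Let $c:\mathcal X\times\mathcal Y\to\mathbb R$ be lower semicontinuous, and suppose there is $c^*\in L^1(\nu)$ with $\sup_{x\in\mathcal X}|c(x,y)|\le c^*(y)$ for all $y\in\mathcal Y$. For an $S$-invariant Borel probability measure $\mu$ on $\mathcal X$, let $\mathcal J(\mu,\nu)$ be the set of joinings of $(\mathcal X,S,\mu)$ and $(\mathcal Y,T,\nu)$, that is, of Borel probability measures on $\mathcal X\times\mathcal Y$ that are invariant under $S\times T$ and have marginals $\mu$ on $\mathcal X$ and $\nu$ on $\mathcal Y$. Let $\mathcal J(S:\nu)=\bigcup_\mu \mathcal J(\mu,\nu)$, the union being over all $S$-invariant Borel probability measures $\mu$ on $\mathcal X$. Put $$C(S:\nu)=\inf_{\lambda\in\mathcal J(S:\nu)}\int c\,d\lambda,\qquad \mathcal J_{\min}(S:\nu)=\Big\{\lambda\in\mathcal J(S:\nu):\int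 c\,d\lambda=C(S:\nu)\Big\}.$$ Then $\mathcal J_{\min}(S:\nu)$ is non-empty, convex, and compact in the topology of weak convergence of probability measures. Furthermore, $\lambda\in\mathcal J_{\min}(S:\nu)$ is an extreme point of $\mathcal J_{\min}(S:\nu)$ if and only if $\lambda$ is ergodic under $S\times T$. -/

import Mathlib

open MeasureTheory Set
open scoped NNReal

noncomputable section

namespace OptimalJoining

variable {X Y : Type*} [MeasurableSpace X] [MeasurableSpace Y]

/-- `𝒥(μ, ν)`: the joinings of `(X, S, μ)` and `(Y, T, ν)`, i.e. the probability measures on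
`X × Y` that are invariant under `S × T` and have marginals `μ` and `ν`. -/
def joinings (S : X → X) (T : Y → Y) (μ : ProbabilityMeasure X) (ν : ProbabilityMeasure Y) :
    Set (ProbabilityMeasure (X × Y)) :=
  {κ | MeasurePreserving (Prod.map S T) (κ : Measure (X × Y)) (κ : Measure (X × Y)) ∧
    (κ : Measure (X × Y)).map Prod.fst = (μ : Measure X) ∧
    (κ : Measure (X × Y)).map Prod.snd = (ν : Measure Y)}

/-- `𝒥(S : ν)`: the union of the sets `𝒥(μ, ν)` over all `S`-invariant probability measures `μ`. -/
def joiningsWith (S : X → X) (T : Y → Y) (ν : ProbabilityMeasure Y) :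
    Set (ProbabilityMeasure (X × Y)) :=
  ⋃ μ ∈ {μ : ProbabilityMeasure X | MeasurePreserving S (μ : Measure X) (μ : Measure X)},
    joinings S T μ ν

/-- `C(S : ν)`: the infimum of `∫ c dκ` over `κ ∈ 𝒥(S : ν)`. When `|c (x, y)|` is dominated by a
`ν`-integrable function of `y`, all these integrals are finite and uniformly bounded. -/
def optimalCost (S : X → X) (T : Y → Y) (ν : ProbabilityMeasure Y) (c : X × Y → ℝ) : ℝ :=
  sInf ((fun κ : ProbabilityMeasure (X × Y) => ∫ p, c p ∂(κ : Measure (X × Y))) ''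
    joiningsWith S T ν)

/-- `𝒥_min(S : ν)`: the joinings in `𝒥(S : ν)` whose expected cost is `C(S : ν)`. -/
def optimalJoinings (S : X → X) (T : Y → Y) (ν : ProbabilityMeasure Y) (c : X × Y → ℝ) :
    Set (ProbabilityMeasure (X × Y)) :=
  {κ ∈ joiningsWith S T ν | ∫ p, c p ∂(κ : Measure (X × Y)) = optimalCost S T ν c}

/-- A set of probability measures regarded as a subset of the `ℝ≥0`-module of all measures, where
convex combinations live. -/
def asMeasures {Ω : Type*} [MeasurableSpace Ω] (M : Set (ProbabilityMeasure Ω)) :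
    Set (Measure Ω) :=
  (fun κ : ProbabilityMeasure Ω => (κ : Measure Ω)) '' M

end OptimalJoining

end

namespace OptimalJoining

open Filter Topology BoundedContinuousFunction

/-! ### Dynamics without topology -/

section Basic

variable {X Y : Type*} [MeasurableSpace X] [MeasurableSpace Y]
  {S : X → X} {T : Y → Y} {ν : ProbabilityMeasure Y} {c : X × Y → ℝ}

/-! Since `T` is only measurable, invariance under `S × T` is not visibly a closed condition for
weak convergence, and `c` may be unbounded. Both difficulties disappear because every competitor has
second marginal `ν`: an integrable function of `y` is approximated in `L¹(ν)` by a bounded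
continuous one, with the same error for all couplings. Hence integrals of `f x * g y` are continuous
on these couplings (`continuousOn_integral_mul`) and the cost is lower semicontinuous
(`lowerSemicontinuousOn_integral`). By Prokhorov's theorem the couplings form a compact set, in
which the joinings are closed (`isCompact_joiningsWith`). The set of joinings is non-empty by
Krylov–Bogoliubov and products, so the cost attains its minimum on a compact set of minimizers.

An ergodic measure dominates no other invariant probability measure, so it is extreme. Conversely, a
non-ergodic optimal joining splits over an invariant set; ergodicity of `ν` keeps both conditional
measures joinings with `ν`, and since neither costs less than the minimum, both are optimal. -/

lemma measurePreserving_of_semiconj {α β : Type*} [MeasurableSpace α] [MeasurableSpace β]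
    {f : α → α} {g : β → β} {π : α → β} {κ : Measure α} (hf : MeasurePreserving f κ κ)
    (hg : Measurable g) (hπ : Measurable π) (h : π ∘ f = g ∘ π) :
    MeasurePreserving g (κ.map π) (κ.map π) := by
  refine ⟨hg, ?_⟩
  rw [Measure.map_map hg hπ, ← h, ← Measure.map_map hπ hf.measurable, hf.map_eq]

/-- The first marginal of an invariant measure is automatically `S`-invariant, so the union over `μ`
imposes nothing beyond invariance and the second marginal. -/
lemma mem_joiningsWith_iff (hS : Measurable S) {κ : ProbabilityMeasure (X × Y)} :
    κ ∈ joiningsWith S T ν ↔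
      MeasurePreserving (Prod.map S T) (κ : Measure (X × Y)) (κ : Measure (X × Y)) ∧
        (κ : Measure (X × Y)).map Prod.snd = (ν : Measure Y) := by
  simp only [joiningsWith, joinings, mem_iUnion, mem_ofPred_eq, exists_prop]
  constructor
  · rintro ⟨μ, -, h, -, h'⟩
    exact ⟨h, h'⟩
  · rintro ⟨h, h'⟩
    refine ⟨κ.map measurable_fst.aemeasurable, ?_, h, rfl, h'⟩
    exact measurePreserving_of_semiconj h hS measurable_fst rfl

lemma prod_mem_joiningsWith {μ : ProbabilityMeasure X}
    (hμ : MeasurePreserving S (μ : Measure X) (μ : Measure X))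
    (hν : MeasurePreserving T (ν : Measure Y) (ν : Measure Y)) :
    μ.prod ν ∈ joiningsWith S T ν := by
  rw [mem_joiningsWith_iff hμ.measurable]
  constructor
  · exact hμ.prod hν
  · simp [ProbabilityMeasure.toMeasure_prod]

lemma measurePreserving_snd {κ : ProbabilityMeasure (X × Y)}
    (h : (κ : Measure (X × Y)).map Prod.snd = (ν : Measure Y)) :
    MeasurePreserving Prod.snd (κ : Measure (X × Y)) (ν : Measure Y) :=
  ⟨measurable_snd, h⟩

lemma integrable_comp_snd {κ : ProbabilityMeasure (X × Y)} {g : Y → ℝ}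
    (h : (κ : Measure (X × Y)).map Prod.snd = (ν : Measure Y)) (hg : Integrable g (ν : Measure Y)) :
    Integrable (fun p => g p.2) (κ : Measure (X × Y)) :=
  (measurePreserving_snd h).integrable_comp_of_integrable hg

lemma integral_comp_snd {κ : ProbabilityMeasure (X × Y)} {g : Y → ℝ}
    (h : (κ : Measure (X × Y)).map Prod.snd = (ν : Measure Y)) (hg : Integrable g (ν : Measure Y)) :
    ∫ p, g p.2 ∂(κ : Measure (X × Y)) = ∫ y, g y ∂(ν : Measure Y) := by
  rw [← h, integral_map measurable_snd.aemeasurable (by rw [h]; exact hg.aestronglyMeasurable)]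

lemma integrable_of_dominated_snd {κ : ProbabilityMeasure (X × Y)} {g : Y → ℝ}
    (h : (κ : Measure (X × Y)).map Prod.snd = (ν : Measure Y)) (hg : Integrable g (ν : Measure Y))
    (hc : Measurable c) (hcg : ∀ x y, |c (x, y)| ≤ g y) :
    Integrable c (κ : Measure (X × Y)) :=
  (integrable_comp_snd h hg).mono' hc.aestronglyMeasurable
    (Eventually.of_forall fun p => hcg p.1 p.2)

lemma abs_integral_le_of_dominated_snd {κ : ProbabilityMeasure (X × Y)} {g : Y → ℝ}
    (h : (κ : Measure (X × Y)).map Prod.snd = (ν : Measure Y)) (hg : Integrable g (ν : Measure Y))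
    (hcg : ∀ x y, |c (x, y)| ≤ g y) :
    |∫ p, c p ∂(κ : Measure (X × Y))| ≤ ∫ y, g y ∂(ν : Measure Y) := by
  rw [← integral_comp_snd h hg]
  exact norm_integral_le_of_norm_le (integrable_comp_snd h hg)
    (Eventually.of_forall fun p => by rw [Real.norm_eq_abs]; exact hcg p.1 p.2)

lemma optimalCost_le {g : Y → ℝ} (hS : Measurable S) (hg : Integrable g (ν : Measure Y))
    (hcg : ∀ x y, |c (x, y)| ≤ g y) {κ : ProbabilityMeasure (X × Y)}
    (hκ : κ ∈ joiningsWith S T ν) :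
    optimalCost S T ν c ≤ ∫ p, c p ∂(κ : Measure (X × Y)) := by
  -- A real infimum is meaningful only for sets bounded below; domination supplies the bound `-∫ g
  -- dν`.
  refine csInf_le ⟨-∫ y, g y ∂(ν : Measure Y), ?_⟩ (mem_image_of_mem _ hκ)
  rintro _ ⟨κ', hκ', rfl⟩
  exact (abs_le.1 (abs_integral_le_of_dominated_snd
    ((mem_joiningsWith_iff hS).1 hκ').2 hg hcg)).1

lemma isProbabilityMeasure_convexComb {Ω : Type*} [MeasurableSpace Ω] {a b : ℝ≥0}
    (hab : a + b = 1) (μ₁ μ₂ : Measure Ω) [IsProbabilityMeasure μ₁] [IsProbabilityMeasure μ₂] :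
    IsProbabilityMeasure (a • μ₁ + b • μ₂) := by
  constructor
  simp only [Measure.coe_add, Pi.add_apply, Measure.smul_apply, measure_univ, ENNReal.smul_def,
    smul_eq_mul, mul_one]
  exact_mod_cast congrArg ((↑) : ℝ≥0 → ENNReal) hab

theorem convex_asMeasures_optimalJoinings {g : Y → ℝ} (hS : Measurable S)
    (hg : Integrable g (ν : Measure Y)) (hc : Measurable c) (hcg : ∀ x y, |c (x, y)| ≤ g y) :
    Convex ℝ≥0 (asMeasures (optimalJoinings S T ν c)) := by
  rintro _ ⟨κ₁, ⟨h₁, hC₁⟩, rfl⟩ _ ⟨κ₂, ⟨h₂, hC₂⟩, rfl⟩ a b - - hab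
  have := isProbabilityMeasure_convexComb hab (κ₁ : Measure (X × Y)) (κ₂ : Measure (X × Y))
  rw [mem_joiningsWith_iff hS] at h₁ h₂
  have hab' : (a : ℝ) + b = 1 := by exact_mod_cast hab
  refine ⟨⟨a • (κ₁ : Measure (X × Y)) + b • (κ₂ : Measure (X × Y)), this⟩,
    ⟨(mem_joiningsWith_iff hS).2 ⟨?_, ?_⟩, ?_⟩, rfl⟩
  · refine ⟨h₁.1.measurable, ?_⟩
    simp only [ProbabilityMeasure.coe_mk]
    rw [Measure.map_add _ _ h₁.1.measurable, Measure.map_smul, Measure.map_smul,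
      h₁.1.map_eq, h₂.1.map_eq]
  · simp only [ProbabilityMeasure.coe_mk]
    rw [Measure.map_add _ _ measurable_snd, Measure.map_smul, Measure.map_smul, h₁.2, h₂.2,
      ← add_smul, hab, one_smul]
  · simp only [ProbabilityMeasure.coe_mk]
    have i₁ := integrable_of_dominated_snd h₁.2 hg hc hcg
    have i₂ := integrable_of_dominated_snd h₂.2 hg hc hcg
    rw [integral_add_measure (i₁.smul_measure_nnreal) (i₂.smul_measure_nnreal),
      integral_smul_nnreal_measure, integral_smul_nnreal_measure, hC₁, hC₂, ← add_smul, hab,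
      one_smul]

/-- A component of positive weight is invariant and absolutely continuous with respect to `κ`, hence
equals `κ` by ergodicity. Optimality matters only for membership. -/
lemma mem_extremePoints_of_ergodic {κ : ProbabilityMeasure (X × Y)} (hS : Measurable S)
    (hκ : κ ∈ optimalJoinings S T ν c) (h : Ergodic (Prod.map S T) (κ : Measure (X × Y))) :
    (κ : Measure (X × Y)) ∈ extremePoints ℝ≥0 (asMeasures (optimalJoinings S T ν c)) := by
  rw [mem_extremePoints_iff_left]
  refine ⟨mem_image_of_mem _ hκ, ?_⟩
  rintro _ ⟨κ₁, h₁, rfl⟩ _ ⟨κ₂, h₂, rfl⟩ ⟨a, b, ha, hb, hab, hκ'⟩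
  refine h.eq_of_absolutelyContinuous ((mem_joiningsWith_iff hS).1 h₁.1).1 ?_
  refine Measure.AbsolutelyContinuous.mk fun s _ hs => ?_
  simp only [← hκ', Measure.coe_add, Pi.add_apply, Measure.smul_apply, add_eq_zero,
    ENNReal.smul_def, smul_eq_mul, mul_eq_zero, ENNReal.coe_eq_zero, ha.ne', false_or] at hs
  exact hs.1

/-- Conditioning on an invariant set preserves invariance. The new second marginal is `T`-invariant
and absolutely continuous with respect to `ν`, so ergodicity of `ν` forces it to be `ν`. -/
lemma exists_mem_joiningsWith_eq_cond {κ : ProbabilityMeasure (X × Y)} (hS : Measurable S)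
    (hT : Ergodic T (ν : Measure Y)) (hκ : κ ∈ joiningsWith S T ν) {s : Set (X × Y)}
    (hs : MeasurableSet s) (hinv : Prod.map S T ⁻¹' s = s) (h0 : (κ : Measure (X × Y)) s ≠ 0) :
    ∃ κ' ∈ joiningsWith S T ν,
      (κ' : Measure (X × Y)) = ProbabilityTheory.cond (κ : Measure (X × Y)) s := by
  have := ProbabilityTheory.cond_isProbabilityMeasure h0
  rw [mem_joiningsWith_iff hS] at hκ
  refine ⟨⟨_, this⟩, (mem_joiningsWith_iff hS).2 ?_, rfl⟩
  simp only [ProbabilityMeasure.coe_mk]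
  have hpres : MeasurePreserving (Prod.map S T)
      (ProbabilityTheory.cond (κ : Measure (X × Y)) s)
      (ProbabilityTheory.cond (κ : Measure (X × Y)) s) := by
    refine .smul_measure ?_ _
    convert! hκ.1.restrict_preimage hs
    exact hinv.symm
  refine ⟨hpres, ?_⟩
  have : IsProbabilityMeasure
      ((ProbabilityTheory.cond (κ : Measure (X × Y)) s).map Prod.snd) :=
    Measure.isProbabilityMeasure_map measurable_snd.aemeasurable
  refine hT.eq_of_absolutelyContinuous
    (measurePreserving_of_semiconj hpres hT.measurable measurable_snd rfl) ?_
  rw [← hκ.2]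
  exact ProbabilityTheory.cond_absolutelyContinuous.map measurable_snd

/-- An invariant set `s` of intermediate measure writes `κ` as an average of its conditionings on
`s` and `sᶜ`. Their costs are at least the minimum and average to it, so both are optimal,
contradicting extremality. -/
lemma ergodic_of_mem_extremePoints {g : Y → ℝ} {κ : ProbabilityMeasure (X × Y)}
    (hS : Measurable S) (hT : Ergodic T (ν : Measure Y))
    (hg : Integrable g (ν : Measure Y)) (hc : Measurable c) (hcg : ∀ x y, |c (x, y)| ≤ g y)
    (hκ : κ ∈ optimalJoinings S T ν c)
    (h : (κ : Measure (X × Y)) ∈ extremePoints ℝ≥0 (asMeasures (optimalJoinings S T ν c))) :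
    Ergodic (Prod.map S T) (κ : Measure (X × Y)) := by
  refine ⟨((mem_joiningsWith_iff hS).1 hκ.1).1, ⟨?_⟩⟩
  intro s hsm hfs
  by_contra H
  obtain ⟨hs, hs'⟩ : (κ : Measure (X × Y)) s ≠ 0 ∧ (κ : Measure (X × Y)) sᶜ ≠ 0 := by
    simpa [eventuallyConst_set, ae_iff, and_comm] using! H
  obtain ⟨κ₁, h₁, hκ₁⟩ := exists_mem_joiningsWith_eq_cond hS hT hκ.1 hsm hfs hs
  obtain ⟨κ₂, h₂, hκ₂⟩ := exists_mem_joiningsWith_eq_cond hS hT hκ.1 hsm.compl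
    (by rw [preimage_compl, hfs]) hs'
  set a : ℝ≥0 := κ s
  set b : ℝ≥0 := κ sᶜ
  have ha' : (a : ENNReal) = (κ : Measure (X × Y)) s :=
    ProbabilityMeasure.ennreal_coeFn_eq_coeFn_toMeasure κ s
  have hb' : (b : ENNReal) = (κ : Measure (X × Y)) sᶜ :=
    ProbabilityMeasure.ennreal_coeFn_eq_coeFn_toMeasure κ sᶜ
  have ha : 0 < a := by
    rw [← ENNReal.coe_pos, ha']; exact pos_iff_ne_zero.2 hs
  have hb : 0 < b := by
    rw [← ENNReal.coe_pos, hb']; exact pos_iff_ne_zero.2 hs'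
  have hab : a + b = 1 := by
    rw [← ENNReal.coe_inj, ENNReal.coe_add, ha', hb', measure_add_measure_compl hsm, measure_univ,
      ENNReal.coe_one]
  have hdecomp : a • (κ₁ : Measure (X × Y)) + b • (κ₂ : Measure (X × Y)) = κ := by
    simp [hκ₁, hκ₂, ProbabilityTheory.cond, ENNReal.smul_def, smul_smul, ha', hb',
      ENNReal.mul_inv_cancel, hs, hs', Measure.restrict_add_restrict_compl hsm]
  have i₁ := integrable_of_dominated_snd ((mem_joiningsWith_iff hS).1 h₁).2 hg hc hcg
  have i₂ := integrable_of_dominated_snd ((mem_joiningsWith_iff hS).1 h₂).2 hg hc hcg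
  have hcost : (a : ℝ) * ∫ p, c p ∂(κ₁ : Measure (X × Y)) +
      b * ∫ p, c p ∂(κ₂ : Measure (X × Y)) = optimalCost S T ν c := by
    rw [← hκ.2, ← hdecomp, integral_add_measure i₁.smul_measure_nnreal i₂.smul_measure_nnreal,
      integral_smul_nnreal_measure, integral_smul_nnreal_measure]
    rfl
  have l₁ := optimalCost_le hS hg hcg h₁
  have l₂ := optimalCost_le hS hg hcg h₂
  have hab' : (a : ℝ) + b = 1 := by exact_mod_cast hab
  have ha0 : (0 : ℝ) < a := by exact_mod_cast ha
  have hb0 : (0 : ℝ) < b := by exact_mod_cast hb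
  have hC : (a : ℝ) * optimalCost S T ν c + b * optimalCost S T ν c = optimalCost S T ν c := by
    rw [← add_mul, hab', one_mul]
  have e₁ : ∫ p, c p ∂(κ₁ : Measure (X × Y)) = optimalCost S T ν c := by
    refine le_antisymm (le_of_mul_le_mul_left ?_ ha0) l₁
    linarith [mul_le_mul_of_nonneg_left l₂ hb0.le]
  have e₂ : ∫ p, c p ∂(κ₂ : Measure (X × Y)) = optimalCost S T ν c := by
    refine le_antisymm (le_of_mul_le_mul_left ?_ hb0) l₂
    linarith [mul_le_mul_of_nonneg_left l₁ ha0.le]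
  have hcond : (κ₁ : Measure (X × Y)) = κ :=
    h.2 (mem_image_of_mem _ ⟨h₁, e₁⟩) (mem_image_of_mem _ ⟨h₂, e₂⟩) ⟨a, b, ha, hb, hab, hdecomp⟩
  -- `κ₁` is concentrated on `s`, whereas `κ` charges `sᶜ`.
  rw [← hcond] at hs'
  simp [hκ₁, ProbabilityTheory.cond_apply, hsm] at hs'

end Basic

/-! ### Invariant measures of continuous maps -/

lemma sum_range_comp_iterate_sub {X : Type*} (f : X → ℝ) (S : X → X) (x : X) (n : ℕ) :
    ∑ i ∈ Finset.range n, f (S (S^[i] x)) - ∑ i ∈ Finset.range n, f (S^[i] x) =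
      f (S^[n] x) - f x := by
  rw [← Finset.sum_sub_distrib]
  simpa only [Function.iterate_succ_apply', Function.iterate_zero, id] using
    Finset.sum_range_sub (fun i => f (S^[i] x)) n

/-- **Krylov–Bogoliubov theorem**: a continuous map of a non-empty compact metrizable space
preserves a Borel probability measure. -/
theorem exists_measurePreserving_of_continuous {X : Type*} [TopologicalSpace X]
    [TopologicalSpace.MetrizableSpace X] [CompactSpace X] [Nonempty X] [MeasurableSpace X]
    [BorelSpace X] {S : X → X} (hS : Continuous S) :
    ∃ μ : ProbabilityMeasure X, MeasurePreserving S (μ : Measure X) (μ : Measure X) := by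
  obtain ⟨x⟩ := ‹Nonempty X›
  -- Empirical measures along the orbit of `x`; averaging over `n + 1` points avoids division by
  -- zero.
  have hprob (n : ℕ) : IsProbabilityMeasure
      (((n : ENNReal) + 1)⁻¹ • ∑ i ∈ Finset.range (n + 1), Measure.dirac (S^[i] x)) := by
    constructor
    simp only [Measure.smul_apply, Measure.coe_finsetSum, Finset.sum_apply, measure_univ,
      Finset.sum_const, Finset.card_range, smul_eq_mul, nsmul_eq_mul, mul_one, Nat.cast_add,
      Nat.cast_one]
    exact ENNReal.inv_mul_cancel (by simp) (by simp)
  let m (n : ℕ) : ProbabilityMeasure X := ⟨_, hprob n⟩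
  have hint (n : ℕ) (f : X → ℝ) (hf : Continuous f) : ∫ z, f z ∂(m n : Measure X) =
      ((n : ℝ) + 1)⁻¹ * ∑ i ∈ Finset.range (n + 1), f (S^[i] x) := by
    simp only [m, ProbabilityMeasure.coe_mk]
    rw [integral_smul_measure, integral_finsetSum_measure]
    · simp [ENNReal.toReal_add]
    · exact fun i _ => integrable_dirac (by simp)
  obtain ⟨μ, -, hμ⟩ := isCompact_univ.ultrafilter_le_nhds
    ((hyperfilter ℕ).map m) (by simp)
  have hlim : Tendsto m (hyperfilter ℕ) (𝓝 μ) := hμ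
  have hle : (hyperfilter ℕ : Filter ℕ) ≤ atTop := by
    rw [← Nat.cofinite_eq_atTop]; exact hyperfilter_le_cofinite
  refine ⟨μ, hS.measurable, ?_⟩
  have : IsProbabilityMeasure ((μ : Measure X).map S) :=
    Measure.isProbabilityMeasure_map hS.measurable.aemeasurable
  refine ext_of_forall_integral_eq_of_IsFiniteMeasure fun f => ?_
  rw [integral_map hS.measurable.aemeasurable f.continuous.aestronglyMeasurable]
  have h₁ := ProbabilityMeasure.tendsto_iff_forall_integral_tendsto.1 hlim f
  have h₂ := ProbabilityMeasure.tendsto_iff_forall_integral_tendsto.1 hlim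
    (f.compContinuous ⟨S, hS⟩)
  have h₃ : Tendsto (fun n : ℕ => ((n : ℝ) + 1)⁻¹ * (2 * ‖f‖)) atTop (𝓝 0) := by
    simpa using (tendsto_one_div_add_atTop_nhds_zero_nat (𝕜 := ℝ)).mul_const (2 * ‖f‖)
  -- Composing with `S` shifts the orbit sum by one; telescoping leaves two boundary terms, at most
  -- `2 * ‖f‖ / (n + 1)`.
  refine sub_eq_zero.1 (tendsto_nhds_unique (h₂.sub h₁) ?_)
  refine squeeze_zero_norm (fun n => ?_) (h₃.mono_left hle)
  rw [hint n _ (BoundedContinuousFunction.continuous _), hint n _ f.continuous, ← mul_sub]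
  simp only [compContinuous_apply, ContinuousMap.coe_mk]
  rw [sum_range_comp_iterate_sub, norm_mul, Real.norm_of_nonneg (by positivity)]
  gcongr
  calc ‖f (S^[n + 1] x) - f x‖ ≤ ‖f (S^[n + 1] x)‖ + ‖f x‖ := norm_sub_le _ _
    _ ≤ ‖f‖ + ‖f‖ := add_le_add (f.norm_coe_le_norm _) (f.norm_coe_le_norm _)
    _ = 2 * ‖f‖ := by ring

/-! ### Lower semicontinuity of integrals -/

/-- The integral of a nonnegative lower semicontinuous function is a lower semicontinuous function
of the probability measure. -/
theorem lowerSemicontinuous_lintegral_ofReal {Ω : Type*} [TopologicalSpace Ω]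
    [TopologicalSpace.PseudoMetrizableSpace Ω] [TopologicalSpace.SeparableSpace Ω]
    [MeasurableSpace Ω] [BorelSpace Ω] {f : Ω → ℝ} (hf : LowerSemicontinuous f) (hf0 : 0 ≤ f) :
    LowerSemicontinuous fun κ : ProbabilityMeasure Ω =>
      ∫⁻ p, ENNReal.ofReal (f p) ∂(κ : Measure Ω) := by
  intro κ a ha
  by_contra hcon
  obtain ⟨κs, hlim, hle⟩ := exists_seq_forall_of_frequently (not_eventually.1 hcon)
  have key : ∫⁻ p, ENNReal.ofReal (f p) ∂(κ : Measure Ω) ≤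
      atTop.liminf fun n => ∫⁻ p, ENNReal.ofReal (f p) ∂(κs n : Measure Ω) := by
    -- Layer-cake formula: superlevel sets are open, so the portmanteau theorem applies at each
    -- level, and Fatou's lemma integrates over the levels.
    simp_rw [lintegral_eq_lintegral_meas_lt _ (Eventually.of_forall hf0) hf.measurable.aemeasurable]
    refine (lintegral_mono fun t => ProbabilityMeasure.le_liminf_measure_open_of_tendsto hlim
      (hf.isOpen_preimage t)).trans ?_
    exact lintegral_liminf_le fun n => Antitone.measurable fun s t hst =>
      measure_mono fun ω hω => lt_of_le_of_lt hst hω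
  refine (ha.trans_le key).not_ge ?_
  refine liminf_le_of_frequently_le' (Frequently.of_forall fun n => not_lt.1 (hle n))

/-! ### Couplings with a prescribed second marginal -/

section Topological

variable {X Y : Type*} [TopologicalSpace X] [MeasurableSpace X] [BorelSpace X]
  [TopologicalSpace Y] [PolishSpace Y] [MeasurableSpace Y] [BorelSpace Y]

/-- Weak convergence with a fixed second marginal passes to products `f x * g y` where `f` is
continuous and `g` is merely integrable. -/
theorem continuousOn_integral_mul (ν : ProbabilityMeasure Y) (f : X →ᵇ ℝ) {g : Y → ℝ}
    (hg : Integrable g (ν : Measure Y)) :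
    ContinuousOn (fun κ : ProbabilityMeasure (X × Y) =>
        ∫ p, f p.1 * g p.2 ∂(κ : Measure (X × Y)))
      {κ | (κ : Measure (X × Y)).map Prod.snd = (ν : Measure Y)} := by
  let := TopologicalSpace.upgradeIsCompletelyMetrizable Y
  refine continuousOn_of_uniform_approx_of_continuousOn fun u hu => ?_
  obtain ⟨ε, hε, hεu⟩ := Metric.mem_uniformity_dist.1 hu
  have hf1 : 0 < ‖f‖ + 1 := by positivity
  -- Replacing `g` by `h` costs at most `‖f‖ * ∫ ‖g - h‖ dν`, uniformly in `κ`; the `+ 1` covers `f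
  -- = 0`.
  obtain ⟨h, hle, hint⟩ := hg.exists_boundedContinuous_integral_sub_le
    (show 0 < ε / 2 / (‖f‖ + 1) by positivity)
  refine ⟨fun κ => ∫ p, f p.1 * h p.2 ∂(κ : Measure (X × Y)), ?_, fun κ hκ => hεu ?_⟩
  · exact (ProbabilityMeasure.continuous_integral_boundedContinuousFunction
      (f.compContinuous ⟨Prod.fst, continuous_fst⟩ *
        h.compContinuous ⟨Prod.snd, continuous_snd⟩)).continuousOn
  · have hfb : ∀ᵐ p ∂(κ : Measure (X × Y)), ‖f p.1‖ ≤ ‖f‖ :=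
      Eventually.of_forall fun p => f.norm_coe_le_norm _
    have hfm : AEStronglyMeasurable (fun p : X × Y => f p.1) (κ : Measure (X × Y)) :=
      (f.continuous.comp continuous_fst).aestronglyMeasurable
    have hdiff : Integrable (fun y => ‖g y - h y‖) (ν : Measure Y) := (hg.sub hint).norm
    rw [Real.dist_eq, ← integral_sub ((integrable_comp_snd hκ hg).bdd_mul hfm hfb)
      ((integrable_comp_snd hκ hint).bdd_mul hfm hfb)]
    calc |∫ p, (f p.1 * g p.2 - f p.1 * h p.2) ∂(κ : Measure (X × Y))|
        ≤ ∫ p, ‖f‖ * ‖g p.2 - h p.2‖ ∂(κ : Measure (X × Y)) := by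
          rw [← Real.norm_eq_abs]
          refine norm_integral_le_of_norm_le ((integrable_comp_snd hκ hdiff).const_mul _)
            (Eventually.of_forall fun p => ?_)
          rw [← mul_sub, norm_mul]
          gcongr
          exact f.norm_coe_le_norm _
      _ = ‖f‖ * ∫ y, ‖g y - h y‖ ∂(ν : Measure Y) := by
          rw [integral_const_mul, integral_comp_snd hκ hdiff]
      _ ≤ (‖f‖ + 1) * (ε / 2 / (‖f‖ + 1)) := by gcongr; linarith
      _ < ε := by rw [mul_div_cancel₀ _ hf1.ne']; linarith

variable [TopologicalSpace.MetrizableSpace X] [CompactSpace X]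

variable (X) in
theorem isCompact_setOfPred_map_snd_eq (ν : ProbabilityMeasure Y) :
    IsCompact {κ : ProbabilityMeasure (X × Y) |
      (κ : Measure (X × Y)).map Prod.snd = (ν : Measure Y)} := by
  have hclosed : IsClosed {κ : ProbabilityMeasure (X × Y) |
      (κ : Measure (X × Y)).map Prod.snd = (ν : Measure Y)} := by
    have : {κ : ProbabilityMeasure (X × Y) |
        (κ : Measure (X × Y)).map Prod.snd = (ν : Measure Y)} =
        (fun κ : ProbabilityMeasure (X × Y) =>
          κ.map (continuous_snd.measurable : Measurable Prod.snd).aemeasurable) ⁻¹' {ν} := by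
      ext κ
      rw [mem_preimage, mem_singleton_iff]
      exact (Subtype.ext_iff (a1 := κ.map _) (a2 := ν)).symm
    rw [this]
    exact isClosed_singleton.preimage (ProbabilityMeasure.continuous_map continuous_snd)
  rw [← hclosed.closure_eq]
  let := TopologicalSpace.upgradeIsCompletelyMetrizable Y
  -- Prokhorov: first marginals are tight because `X` is compact, and the only second marginal is
  -- `ν`, which is tight because `Y` is Polish.
  refine isCompact_closure_of_isTightMeasureSet (IsTightMeasureSet.prodMk .of_compactSpace
    ((isTightMeasureSet_singleton (μ := (ν : Measure Y))).subset ?_))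
  rintro _ ⟨_, ⟨κ, hκ, rfl⟩, rfl⟩
  exact hκ

theorem isCompact_joiningsWith {S : X → X} {T : Y → Y} {ν : ProbabilityMeasure Y}
    (hS : Continuous S) (hT : MeasurePreserving T (ν : Measure Y) (ν : Measure Y)) :
    IsCompact (joiningsWith S T ν) := by
  let := TopologicalSpace.upgradeIsCompletelyMetrizable Y
  set M : Set (ProbabilityMeasure (X × Y)) :=
    {κ | (κ : Measure (X × Y)).map Prod.snd = (ν : Measure Y)} with hM
  have hMc : IsCompact M := isCompact_setOfPred_map_snd_eq X ν
  have hST : Measurable (Prod.map S T) := hS.measurable.prodMap hT.measurable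
  -- Products `f x * g y` determine a probability measure, so they suffice to test invariance. Each
  -- condition is intersected with `M` because `g ∘ T` need not be continuous, and continuity of the
  -- integral is known only on `M`.
  have key : joiningsWith S T ν = M ∩ ⋂ (f : X →ᵇ ℝ) (g : Y →ᵇ ℝ),
      (M ∩ (fun κ : ProbabilityMeasure (X × Y) =>
        ∫ p, f (S p.1) * g (T p.2) ∂(κ : Measure (X × Y)) -
          ∫ p, f p.1 * g p.2 ∂(κ : Measure (X × Y))) ⁻¹' {0}) := by
    ext κ
    rw [mem_joiningsWith_iff hS.measurable, mem_inter_iff, mem_iInter₂]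
    have hcomp (f : X →ᵇ ℝ) (g : Y →ᵇ ℝ) :
        ∫ p, f p.1 * g p.2 ∂((κ : Measure (X × Y)).map (Prod.map S T)) =
          ∫ p, f (S p.1) * g (T p.2) ∂(κ : Measure (X × Y)) :=
      integral_map hST.aemeasurable ((f.continuous.comp continuous_fst).mul
        (g.continuous.comp continuous_snd)).aestronglyMeasurable
    constructor
    · rintro ⟨h, h'⟩
      refine ⟨h', fun f g => ⟨h', ?_⟩⟩
      rw [mem_preimage, mem_singleton_iff, ← hcomp, h.map_eq, sub_self]
    · rintro ⟨h', h⟩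
      refine ⟨⟨hST, ?_⟩, h'⟩
      have : IsProbabilityMeasure ((κ : Measure (X × Y)).map (Prod.map S T)) :=
        Measure.isProbabilityMeasure_map hST.aemeasurable
      refine Measure.ext_of_integral_mul_boundedContinuousFunction fun f g => ?_
      rw [hcomp]
      exact sub_eq_zero.1 (h f g).2
  rw [key]
  refine hMc.inter_right (isClosed_iInter fun f => isClosed_iInter fun g => ?_)
  have hgint : Integrable g (ν : Measure Y) := g.integrable _
  exact ((continuousOn_integral_mul ν (f.compContinuous ⟨S, hS⟩)
    (hT.integrable_comp_of_integrable hgint)).sub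
      (continuousOn_integral_mul ν f hgint)).preimage_isClosed_of_isClosed
        hMc.isClosed isClosed_singleton

/-- The cost functional is lower semicontinuous on measures with second marginal `ν`. -/
theorem lowerSemicontinuousOn_integral {ν : ProbabilityMeasure Y} {c : X × Y → ℝ}
    (hc : LowerSemicontinuous c) {g : Y → ℝ} (hg : Integrable g (ν : Measure Y))
    (hcg : ∀ x y, |c (x, y)| ≤ g y) :
    LowerSemicontinuousOn (fun κ : ProbabilityMeasure (X × Y) =>
        ∫ p, c p ∂(κ : Measure (X × Y)))
      {κ | (κ : Measure (X × Y)).map Prod.snd = (ν : Measure Y)} := by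
  let := TopologicalSpace.upgradeIsCompletelyMetrizable Y
  intro κ₀ hκ₀ a ha
  dsimp only at ha
  set ε := ∫ p, c p ∂(κ₀ : Measure (X × Y)) - a with hεdef
  have hε : 0 < ε := sub_pos.2 ha
  obtain ⟨h, hle, hint⟩ := hg.exists_boundedContinuous_integral_sub_le (half_pos hε)
  -- `c + g` is nonnegative but need not be lower semicontinuous. With the continuous `h` in place
  -- of `g`, truncating at `0` restores nonnegativity and changes `c + h` by at most `|g - h|`.
  set G : X × Y → ℝ := fun p => max (c p + h p.2) 0 with hG
  have hGlsc : LowerSemicontinuous G :=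
    (hc.add (h.continuous.comp continuous_snd).lowerSemicontinuous).sup
      lowerSemicontinuous_const
  have hG0 : 0 ≤ G := fun p => le_max_right _ _
  have hdiff : Integrable (fun y => ‖g y - h y‖) (ν : Measure Y) := (hg.sub hint).norm
  have hlow (p : X × Y) : c p + h p.2 ≤ G p := le_max_left _ _
  have hupp (p : X × Y) : G p ≤ c p + h p.2 + ‖g p.2 - h p.2‖ := by
    have h₁ := (abs_le.1 (hcg p.1 p.2)).1
    have h₂ := le_abs_self (g p.2 - h p.2)
    rw [Real.norm_eq_abs]
    exact max_le (by linarith [abs_nonneg (g p.2 - h p.2)]) (by linarith)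
  have hcint {κ : ProbabilityMeasure (X × Y)}
      (hκ : (κ : Measure (X × Y)).map Prod.snd = (ν : Measure Y)) :
      Integrable (fun p => c p + h p.2) (κ : Measure (X × Y)) :=
    (integrable_of_dominated_snd hκ hg hc.measurable hcg).add (integrable_comp_snd hκ hint)
  have hGint {κ : ProbabilityMeasure (X × Y)}
      (hκ : (κ : Measure (X × Y)).map Prod.snd = (ν : Measure Y)) :
      Integrable G (κ : Measure (X × Y)) := (hcint hκ).sup (integrable_const 0)
  have hsum {κ : ProbabilityMeasure (X × Y)}
      (hκ : (κ : Measure (X × Y)).map Prod.snd = (ν : Measure Y)) :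
      ∫ p, (c p + h p.2) ∂(κ : Measure (X × Y)) =
        ∫ p, c p ∂(κ : Measure (X × Y)) + ∫ y, h y ∂(ν : Measure Y) := by
    rw [integral_add (integrable_of_dominated_snd hκ hg hc.measurable hcg)
      (integrable_comp_snd hκ hint), integral_comp_snd hκ hint]
  -- The gap `ε` is split in two: one half separates `b` from the value at `κ₀`, the other absorbs
  -- `∫ ‖g - h‖ dν`.
  set b := a + ∫ y, h y ∂(ν : Measure Y) + ε / 2 with hb
  have hb₀ : b < ∫ p, G p ∂(κ₀ : Measure (X × Y)) := by
    have := integral_mono (hcint hκ₀) (hGint hκ₀) hlow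
    rw [hsum hκ₀] at this
    linarith
  have hev : ∀ᶠ κ : ProbabilityMeasure (X × Y) in
      𝓝[{κ | (κ : Measure (X × Y)).map Prod.snd = (ν : Measure Y)}] κ₀,
      b < ∫ p, G p ∂(κ : Measure (X × Y)) := by
    -- `ENNReal.ofReal` does not see negative thresholds, but those lie below every integral of `G ≥
    -- 0`.
    rcases lt_or_ge b 0 with hneg | hnn
    · exact Eventually.of_forall fun κ => hneg.trans_le (integral_nonneg hG0)
    have hb₁ : ENNReal.ofReal b < ∫⁻ p, ENNReal.ofReal (G p) ∂(κ₀ : Measure (X × Y)) := by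
      rw [← ofReal_integral_eq_lintegral_ofReal (hGint hκ₀) (Eventually.of_forall hG0)]
      exact (ENNReal.ofReal_lt_ofReal_iff (hnn.trans_lt hb₀)).2 hb₀
    filter_upwards [nhdsWithin_le_nhds
      (lowerSemicontinuous_lintegral_ofReal hGlsc hG0 κ₀ _ hb₁), self_mem_nhdsWithin] with κ hκb hκ
    rw [← ofReal_integral_eq_lintegral_ofReal (hGint hκ) (Eventually.of_forall hG0)] at hκb
    exact (ENNReal.ofReal_lt_ofReal_iff_of_nonneg hnn).1 hκb
  filter_upwards [hev, self_mem_nhdsWithin] with κ hκb hκ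
  have := integral_mono (hGint hκ) ((hcint hκ).add (integrable_comp_snd hκ hdiff)) hupp
  rw [integral_add' (hcint hκ) (integrable_comp_snd hκ hdiff), hsum hκ,
    integral_comp_snd hκ hdiff] at this
  linarith

end Topological

end OptimalJoining
theorem theorem2 {X Y : Type*}
    [MetricSpace X] [CompactSpace X] [Nonempty X] [MeasurableSpace X] [BorelSpace X]
    [TopologicalSpace Y] [PolishSpace Y] [MeasurableSpace Y] [BorelSpace Y]
    (S : X → X) (hS : Continuous S)
    (T : Y → Y) (ν : ProbabilityMeasure Y) (hT : Ergodic T (ν : Measure Y))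
    (c : X × Y → ℝ) (hc : LowerSemicontinuous c)
    (hdom : ∃ cstar : Y → ℝ, Integrable cstar (ν : Measure Y) ∧
      ∀ x y, |c (x, y)| ≤ cstar y) :
    (OptimalJoining.optimalJoinings S T ν c).Nonempty ∧
    Convex ℝ≥0 (OptimalJoining.asMeasures (OptimalJoining.optimalJoinings S T ν c)) ∧
    IsCompact (OptimalJoining.optimalJoinings S T ν c) ∧
    ∀ κ ∈ OptimalJoining.optimalJoinings S T ν c,
      ((κ : Measure (X × Y)) ∈ Set.extremePoints ℝ≥0
          (OptimalJoining.asMeasures (OptimalJoining.optimalJoinings S T ν c)) ↔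
        Ergodic (Prod.map S T) (κ : Measure (X × Y))) := by
  obtain ⟨g, hg, hcg⟩ := hdom
  have hSm : Measurable S := hS.measurable
  have hcm : Measurable c := hc.measurable
  have hcomp := OptimalJoining.isCompact_joiningsWith hS hT.toMeasurePreserving
  have hlsc : LowerSemicontinuousOn (fun κ : ProbabilityMeasure (X × Y) =>
      ∫ p, c p ∂(κ : Measure (X × Y))) (OptimalJoining.joiningsWith S T ν) :=
    (OptimalJoining.lowerSemicontinuousOn_integral hc hg hcg).mono fun κ hκ =>
      ((OptimalJoining.mem_joiningsWith_iff hSm).1 hκ).2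
  obtain ⟨μ, hμ⟩ := OptimalJoining.exists_measurePreserving_of_continuous hS
  have hne : (OptimalJoining.joiningsWith S T ν).Nonempty :=
    ⟨_, OptimalJoining.prod_mem_joiningsWith hμ hT.toMeasurePreserving⟩
  refine ⟨?_, OptimalJoining.convex_asMeasures_optimalJoinings hSm hg hcm hcg, ?_,
    fun κ hκ => ⟨OptimalJoining.ergodic_of_mem_extremePoints hSm hT hg hcm hcg hκ,
      OptimalJoining.mem_extremePoints_of_ergodic hSm hκ⟩⟩
  · obtain ⟨κ, hκ, hmin⟩ := hlsc.exists_isMinOn hne hcomp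
    refine ⟨κ, hκ, le_antisymm (le_csInf (hne.image _) ?_)
      (OptimalJoining.optimalCost_le hSm hg hcg hκ)⟩
    rintro _ ⟨κ', hκ', rfl⟩
    exact hmin hκ'
  -- No joining costs less than the infimum, so the minimizers form a sublevel set, relatively
  -- closed by lower semicontinuity.
  · have hset : OptimalJoining.optimalJoinings S T ν c = OptimalJoining.joiningsWith S T ν ∩
        (fun κ : ProbabilityMeasure (X × Y) => ∫ p, c p ∂(κ : Measure (X × Y))) ⁻¹'
          Iic (OptimalJoining.optimalCost S T ν c) := by
      ext κ
      exact and_congr_right fun hκ =>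
        ⟨le_of_eq, fun h => le_antisymm h (OptimalJoining.optimalCost_le hSm hg hcg hκ)⟩
    obtain ⟨v, hv, hveq⟩ := lowerSemicontinuousOn_iff_preimage_Iic.1 hlsc
      (OptimalJoining.optimalCost S T ν c)
    rw [hset, hveq]
    exact hcomp.inter_right hv
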